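/- Let $n\ge 3$ and let $K_n$ be the Kauffman monoid, i.e. the monoid with generators $c,h_1,\dots,h_{n-1}$ and defining relations $h_ih_j=h_jh_i$ for $|i-j|\ge 2$, $h_ih_jh_i=h_i$ for $|i-j|=1$, and $h_i^2=ch_i=h_ic$ for all $1\le i<n$. For $1\le i\le j<n$ let $h[j,i]=h_jh_{j-1}\cdots h_{i+1}h_i$ (a block) and $h[i,j]=h_ih_{i+1}\cdots h_j$ (an inverse block). A block $h[j,i]$ is blue if $i,j$ are both odd, and red if $i,j$ are both even. A word is in Jones normal form if it is $c^\ell h[b_1,a_1]\cdots h[b_k,a_k]$ with $k,\ell\ge 0$, $1\le a_m\le b_m<n$ for all $m$, $a_1<\cdots<a_k$ and $b_1<\cdots<b_k$. For such a word $w$ put $$\chi(w)=\ell-\bigl|\#\{\text{blue blocks of }w\}-\#\{\text{red blocks of }w\}\bigr|.$$ Let $E_n$ be the set of all idempotents of $K_n$ and $\langle E_n\rangle$ the submonoid that it generates (equivalently, since $1\in E_n$, the subsemigroup that it generates). 1. Let $w=c^\ell h[b_1,a_1]\cdots h[b_k,a_k]$ be in Jones normal form, with $k\ge 1$ or $\ell=0$.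 Then the element of $K_n$ represented by $w$ lies in $\langle E_n\rangle$ if and only if $\chi(w)$ is non-negative and even. 2. In the remaining case $k=0$, $\ell\ge 1$: no element $c^\ell$ with $\ell\ge 1$ lies in $\langle E_n\rangle$. 3. $\langle E_n\rangle$ is generated, as a monoid, by the blocks $h[i+1,i]$ and inverse blocks $h[i,i+1]$ of length $2$, where $1\le i\le n-2$. -/

import Mathlib

namespace Kauffman

/-- The generators `c, h_1, …, h_{n-1}` of the Kauffman monoid `K_n`. -/
inductive Gen (n : ℕ) : Type
  | c : Gen n
  | h (i : ℕ) (one_le : 1 ≤ i) (lt : i < n) : Gen n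

/-- The defining relations of the Kauffman monoid `K_n`. -/
inductive Rel (n : ℕ) : FreeMonoid (Gen n) → FreeMonoid (Gen n) → Prop
  | comm (i j : ℕ) (hi : 1 ≤ i) (hi' : i < n) (hj : 1 ≤ j) (hj' : j < n)
      (hij : i + 2 ≤ j ∨ j + 2 ≤ i) :
      Rel n (FreeMonoid.of (Gen.h i hi hi') * FreeMonoid.of (Gen.h j hj hj'))
        (FreeMonoid.of (Gen.h j hj hj') * FreeMonoid.of (Gen.h i hi hi'))
  | braid (i j : ℕ) (hi : 1 ≤ i) (hi' : i < n) (hj : 1 ≤ j) (hj' : j < n)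
      (hij : i + 1 = j ∨ j + 1 = i) :
      Rel n (FreeMonoid.of (Gen.h i hi hi') * FreeMonoid.of (Gen.h j hj hj') *
          FreeMonoid.of (Gen.h i hi hi'))
        (FreeMonoid.of (Gen.h i hi hi'))
  | square (i : ℕ) (hi : 1 ≤ i) (hi' : i < n) :
      Rel n (FreeMonoid.of (Gen.h i hi hi') * FreeMonoid.of (Gen.h i hi hi'))
        (FreeMonoid.of Gen.c * FreeMonoid.of (Gen.h i hi hi'))
  | central (i : ℕ) (hi : 1 ≤ i) (hi' : i < n) :
      Rel n (FreeMonoid.of Gen.c * FreeMonoid.of (Gen.h i hi hi'))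
        (FreeMonoid.of (Gen.h i hi hi') * FreeMonoid.of Gen.c)

/-- The Kauffman monoid `K_n`, given by its monoid presentation. -/
abbrev K (n : ℕ) : Type := PresentedMonoid (Rel n)

/-- The element `c` of `K_n`. -/
def c (n : ℕ) : K n := PresentedMonoid.of (Rel n) Gen.c

/-- The element `h_i` of `K_n`, for `1 ≤ i < n`. (Outside this range, where it is never used,
the value is `1`.) -/
def h (n i : ℕ) : K n :=
  if hi : 1 ≤ i ∧ i < n then PresentedMonoid.of (Rel n) (Gen.h i hi.1 hi.2) else 1

/-- The block `h[j,i] = h_j h_{j-1} ⋯ h_{i+1} h_i`, for `1 ≤ i ≤ j < n`. -/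
def block (n j i : ℕ) : K n :=
  (((List.range' i (j + 1 - i)).reverse).map (h n)).prod

/-- The inverse block `h[i,j] = h_i h_{i+1} ⋯ h_j`, for `1 ≤ i ≤ j < n`. -/
def invBlock (n i j : ℕ) : K n :=
  ((List.range' i (j + 1 - i)).map (h n)).prod

/-- A word `c^ℓ h[b_1,a_1] ⋯ h[b_k,a_k]` in Jones normal form; the block `h[b,a]` is recorded as
the pair `(b, a)`. -/
structure JonesNormalForm (n : ℕ) where
  /-- the number `ℓ` of occurrences of `c` -/
  cCount : ℕ
  /-- the list of blocks `(b_1, a_1), …, (b_k, a_k)` -/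
  blocks : List (ℕ × ℕ)
  valid : ∀ p ∈ blocks, 1 ≤ p.2 ∧ p.2 ≤ p.1 ∧ p.1 < n
  increasing : blocks.Pairwise fun p q => p.1 < q.1 ∧ p.2 < q.2

namespace JonesNormalForm

variable {n : ℕ}

/-- The element of `K_n` represented by a word in Jones normal form. -/
def value (w : JonesNormalForm n) : K n :=
  c n ^ w.cCount * (w.blocks.map fun p => block n p.1 p.2).prod

/-- The number of blue blocks (both indices odd). -/
def blue (w : JonesNormalForm n) : ℕ :=
  w.blocks.countP fun p => decide (Odd p.1 ∧ Odd p.2)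

/-- The number of red blocks (both indices even). -/
def red (w : JonesNormalForm n) : ℕ :=
  w.blocks.countP fun p => decide (Even p.1 ∧ Even p.2)

/-- The characteristic number `χ(w) = |w|_c - |blue(w) - red(w)|`, an integer. -/
def chi (w : JonesNormalForm n) : ℤ :=
  (w.cCount : ℤ) - |(w.blue : ℤ) - (w.red : ℤ)|

end JonesNormalForm

/-- The set `E_n` of all idempotents of `K_n`. -/
def idempotents (n : ℕ) : Set (K n) := {e | IsIdempotentElem e}

/-- The set of all blocks `h[i+1,i]` and inverse blocks `h[i,i+1]` of length two. -/
def shortBlocks (n : ℕ) : Set (K n) :=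
  {x | ∃ i : ℕ, 1 ≤ i ∧ i + 1 < n ∧ (x = block n (i + 1) i ∨ x = invBlock n i (i + 1))}

/-- The idempotent generated subsemigroup `⟨E_n⟩` of `K_n`. As `1` is an idempotent, generation as
a monoid and as a semigroup give the same set. -/
def idempotentGenerated (n : ℕ) : Submonoid (K n) := Submonoid.closure (idempotents n)

end Kauffman

namespace Kauffman

variable {n : ℕ}

/-! ### The relations of the Kauffman monoid -/

/-! Let the weight `wt` of a word in the `h_i` be its number of odd letters minus its number of even
letters. Commutations preserve weight, and so do braid relations, which delete two neighbouring
letters of opposite sign. A square deletes one letter and creates one `c`. Hence if a word u equals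
c^(p+q) v, with p loops coming from odd and q from even letters, then wt u = wt v + p - q. `Reduces`
keeps this account. It also bounds length, for inductions, and ensures that a nonempty word never
becomes empty.

Signs alternate along a block, so blue blocks weigh 1, red ones -1 and all others 0; thus χ = ℓ -
|wt|. A product of short blocks has weight 0, so its normal form has ℓ = p + q and weight q - p,
whence χ = 2 min(p, q). This needs Jones normal forms to exist (`exists_jones`) and to be unique
(`IsJones.unique`); uniqueness is read off from an action on diagrams with a loop counter.

Conversely, `c_pow_mul_val_mem` factors c^ℓ v, for v nonempty or ℓ = 0, into short blocks whenever ℓ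
- |wt v| is non-negative and even. The factors split off are h_i h_j with i, j of opposite parity,
and odd powers of c times h_i.

For an idempotent, comparing the normal forms of e and e² leaves no room for a `c` and forces weight
0. So idempotents are products of short blocks, which are themselves idempotent. -/

theorem h_of_valid {i : ℕ} (hi : 1 ≤ i) (hi' : i < n) :
    h n i = PresentedMonoid.of (Rel n) (Gen.h i hi hi') := by
  simp [h, hi, hi']

theorem commute_c (x : K n) : Commute (c n) x := by
  have hx : x ∈ Submonoid.closure (Set.range (PresentedMonoid.of (Rel n))) := by simp
  induction hx using Submonoid.closure_induction with
  | mem x hx =>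
    obtain ⟨g, rfl⟩ := hx
    cases g with
    | c => exact Commute.refl _
    | h i hi hi' => exact PresentedMonoid.mk_eq_mk_of_rel (Rel.central i hi hi')
  | one => exact Commute.one_right _
  | mul x y _ _ hx hy => exact hx.mul_right hy

/-- The default value 1 of `h` outside the range makes range hypotheses unnecessary here and in
`commute_val`. -/
theorem commute_h {i j : ℕ} (hij : i + 2 ≤ j ∨ j + 2 ≤ i) : Commute (h n i) (h n j) := by
  by_cases hi : 1 ≤ i ∧ i < n
  · by_cases hj : 1 ≤ j ∧ j < n
    · rw [h_of_valid hi.1 hi.2, h_of_valid hj.1 hj.2]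
      exact PresentedMonoid.mk_eq_mk_of_rel (Rel.comm i j hi.1 hi.2 hj.1 hj.2 hij)
    · rw [h, h, dif_neg hj]
      exact Commute.one_right _
  · rw [h, dif_neg hi]
    exact Commute.one_left _

theorem h_mul_h_mul_h {i j : ℕ} (hi : 1 ≤ i) (hi' : i < n) (hj : 1 ≤ j) (hj' : j < n)
    (hij : i + 1 = j ∨ j + 1 = i) : h n i * h n j * h n i = h n i := by
  rw [h_of_valid hi hi', h_of_valid hj hj']
  exact PresentedMonoid.mk_eq_mk_of_rel (Rel.braid i j hi hi' hj hj' hij)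

theorem h_mul_self {i : ℕ} (hi : 1 ≤ i) (hi' : i < n) : h n i * h n i = c n * h n i := by
  rw [h_of_valid hi hi']
  exact PresentedMonoid.mk_eq_mk_of_rel (Rel.square i hi hi')

/-! ### Words in the generators `h_i` -/

/-- The element of `K_n` represented by the word `h_{u_1} h_{u_2} ⋯`. -/
def val (n : ℕ) (u : List ℕ) : K n := (u.map (h n)).prod

@[simp] theorem val_nil : val n [] = 1 := rfl

@[simp] theorem val_cons (i : ℕ) (u : List ℕ) : val n (i :: u) = h n i * val n u := by
  simp [val]

@[simp] theorem val_append (u v : List ℕ) : val n (u ++ v) = val n u * val n v := by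
  simp [val]

/-- The sign of a letter: `1` for odd indices, `-1` for even ones. -/
def sgn (i : ℕ) : ℤ := if Odd i then 1 else -1

/-- The number of odd letters minus the number of even letters. -/
def wt (u : List ℕ) : ℤ := (u.map sgn).sum

@[simp] theorem wt_nil : wt [] = 0 := rfl

@[simp] theorem wt_cons (i : ℕ) (u : List ℕ) : wt (i :: u) = sgn i + wt u := by
  simp [wt]

@[simp] theorem wt_append (u v : List ℕ) : wt (u ++ v) = wt u + wt v := by
  simp [wt]

theorem sgn_succ (i : ℕ) : sgn (i + 1) = - sgn i := by
  unfold sgn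
  grind

theorem sgn_eq (i : ℕ) : sgn i = 1 ∨ sgn i = -1 := by
  unfold sgn
  grind

/-- All letters of the word are indices of generators of `K_n`. -/
def Valid (n : ℕ) (u : List ℕ) : Prop := ∀ i ∈ u, 1 ≤ i ∧ i < n

theorem commute_val {u v : List ℕ} (huv : ∀ i ∈ u, ∀ j ∈ v, i + 2 ≤ j ∨ j + 2 ≤ i) :
    Commute (val n u) (val n v) := by
  induction u with
  | nil => exact Commute.one_left _
  | cons i u ih =>
    rw [val_cons]
    refine Commute.mul_left ?_ (ih fun i hi => huv i (by simp [hi]))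
    clear ih
    induction v with
    | nil => exact Commute.one_right _
    | cons j v ih =>
      rw [val_cons]
      exact (commute_h (huv i (by simp) j (by simp))).mul_right
        (ih fun i hi j hj => huv i hi j (by simp [hj]))

/-- `Reduces n u v` says that the word `u` can be transformed into a power of `c` times `v`, where
the weight records how many of the loops arise from odd and from even letters. -/
def Reduces (n : ℕ) (u v : List ℕ) : Prop :=
  ∃ p q : ℕ, val n u = c n ^ (p + q) * val n v ∧ wt u = wt v + p - q ∧
    v.length + p + q ≤ u.length ∧ (v = [] → u = []) ∧ v ⊆ u

theorem Reduces.refl (u : List ℕ) : Reduces n u u := ⟨0, 0, by simp⟩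

theorem Reduces.trans {u v w : List ℕ} (huv : Reduces n u v) (hvw : Reduces n v w) :
    Reduces n u w := by
  obtain ⟨p, q, h1, h2, h3, h4, h5⟩ := huv
  obtain ⟨p', q', h1', h2', h3', h4', h5'⟩ := hvw
  refine ⟨p + p', q + q', ?_, ?_, by omega, fun hw => h4 (h4' hw), List.Subset.trans h5' h5⟩
  · rw [h1, h1', ← mul_assoc, ← pow_add]
    congr 2
    omega
  · rw [h2, h2']
    push_cast
    ring

theorem Reduces.append {u v u' v' : List ℕ} (huv : Reduces n u v) (huv' : Reduces n u' v') :
    Reduces n (u ++ u') (v ++ v') := by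
  obtain ⟨p, q, h1, h2, h3, h4, h5⟩ := huv
  obtain ⟨p', q', h1', h2', h3', h4', h5'⟩ := huv'
  refine ⟨p + p', q + q', ?_, ?_, ?_, ?_, ?_⟩
  · have hc := ((commute_c (val n v)).pow_left (p' + q')).eq
    rw [val_append, val_append, h1, h1', show p + p' + (q + q') = p + q + (p' + q') by omega,
      pow_add _ (p + q), mul_assoc, mul_assoc, ← mul_assoc (val n v), ← hc, mul_assoc]
  · rw [wt_append, wt_append, h2, h2']
    push_cast
    ring
  · simp only [List.length_append]
    omega
  · simp only [List.append_eq_nil_iff]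
    exact fun hv => ⟨h4 hv.1, h4' hv.2⟩
  · simp only [List.append_subset]
    exact ⟨List.Subset.trans h5 (List.subset_append_left _ _),
      List.Subset.trans h5' (List.subset_append_right _ _)⟩

theorem Reduces.valid {u v : List ℕ} (huv : Reduces n u v) (hu : Valid n u) : Valid n v := by
  obtain ⟨p, q, -, -, -, -, h5⟩ := huv
  exact fun i hi => hu i (h5 hi)

theorem Reduces.subset {u v : List ℕ} (huv : Reduces n u v) : v ⊆ u := by
  obtain ⟨p, q, -, -, -, -, h5⟩ := huv
  exact h5

theorem Reduces.length_le {u v : List ℕ} (huv : Reduces n u v) : v.length ≤ u.length := by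
  obtain ⟨p, q, -, -, h3, -, -⟩ := huv
  omega

theorem Reduces.swap {u v : List ℕ} (huv : ∀ i ∈ u, ∀ j ∈ v, i + 2 ≤ j ∨ j + 2 ≤ i) :
    Reduces n (u ++ v) (v ++ u) := by
  refine ⟨0, 0, ?_, ?_, ?_, ?_, ?_⟩
  · simpa using (commute_val huv).eq
  · simp [add_comm]
  · simp [add_comm]
  · simp +contextual
  · intro x hx
    simpa [or_comm] using hx

theorem Reduces.braid {i j : ℕ} (hi : 1 ≤ i) (hi' : i < n) (hj : 1 ≤ j) (hj' : j < n)
    (hij : i + 1 = j ∨ j + 1 = i) : Reduces n [i, j, i] [i] := by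
  refine ⟨0, 0, ?_, ?_, by simp, by simp, by simp⟩
  · simpa [mul_assoc] using h_mul_h_mul_h hi hi' hj hj' hij
  · rcases hij with rfl | rfl <;> simp [sgn_succ]

/-- The sign of the letter decides whether the new `c` is counted in `p` or in `q`. -/
theorem Reduces.loop {i : ℕ} (hi : 1 ≤ i) (hi' : i < n) : Reduces n [i, i] [i] := by
  rcases sgn_eq i with hs | hs
  · exact ⟨1, 0, by simpa using h_mul_self hi hi', by simp [hs], by simp, by simp, by simp⟩
  · exact ⟨0, 1, by simpa using h_mul_self hi hi', by simp [hs], by simp, by simp, by simp⟩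

/-! ### Block words -/

/-- The word `b, b - 1, …, a`. -/
def blockWord (b a : ℕ) : List ℕ := (List.range' a (b + 1 - a)).reverse

theorem mem_blockWord {b a i : ℕ} : i ∈ blockWord b a ↔ a ≤ i ∧ i ≤ b := by
  simp only [blockWord, List.mem_reverse, List.mem_range'_1]
  omega

theorem blockWord_split {b a j : ℕ} (haj : a ≤ j + 1) (hjb : j ≤ b) :
    blockWord b a = blockWord b (j + 1) ++ blockWord j a := by
  unfold blockWord
  rw [← List.reverse_append]
  congr 1
  have := List.range'_append_1 (s := a) (m := j + 1 - a) (n := b + 1 - (j + 1))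
  rw [show a + (j + 1 - a) = j + 1 by omega,
    show j + 1 - a + (b + 1 - (j + 1)) = b + 1 - a by omega] at this
  exact this.symm

theorem blockWord_self (a : ℕ) : blockWord a a = [a] := by
  simp [blockWord]

theorem blockWord_of_lt {b a : ℕ} (hba : b < a) : blockWord b a = [] := by
  simp only [blockWord, List.reverse_eq_nil_iff, List.range'_eq_nil_iff]
  omega

theorem blockWord_concat {b a : ℕ} (hab : a ≤ b) : blockWord b a = blockWord b (a + 1) ++ [a] := by
  rw [blockWord_split (j := a) (by omega) hab, blockWord_self]

theorem blockWord_cons {b a : ℕ} (hab : a ≤ b + 1) :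
    blockWord (b + 1) a = (b + 1) :: blockWord b a := by
  rw [blockWord_split (j := b) (by omega) (by omega), blockWord_self]
  rfl

/-- The new letter commutes to the front, extends the block, or closes a loop with its last letter.
If it lies higher, it meets its own copy in the block: a braid relation deletes the letter in
between and cuts the block in two, and the lower piece commutes to the front. The value a = m + 1
encodes the empty block. -/
theorem blockWord_append_reduces {m a j : ℕ} (ha : 1 ≤ a) (hj : 1 ≤ j) (hjm : j ≤ m) (hmn : m < n)
    (ham : a ≤ m + 1) : ∃ w a', (∀ i ∈ w, i < m) ∧ 1 ≤ a' ∧ a' ≤ m + 1 ∧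
      Reduces n (blockWord m a ++ [j]) (w ++ blockWord m a') := by
  rcases lt_trichotomy (j + 1) a with hlt | rfl | hlt
  · refine ⟨[j], a, by simp; omega, ha, ham, Reduces.swap ?_⟩
    simp only [mem_blockWord, List.mem_singleton]
    omega
  · refine ⟨[], j, by simp, hj, by omega, ?_⟩
    rw [List.nil_append, blockWord_concat hjm]
    exact Reduces.refl _
  rcases Nat.eq_or_lt_of_le (Nat.lt_succ_iff.mp hlt) with rfl | hlt
  · refine ⟨[], a, by simp, hj, by omega, ?_⟩
    rw [List.nil_append, blockWord_concat hjm, List.append_assoc]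
    exact (Reduces.refl _).append (Reduces.loop hj (by omega))
  · obtain ⟨t, rfl⟩ : ∃ t, j = t + 2 := ⟨j - 2, by omega⟩
    refine ⟨blockWord t a, t + 2, ?_, by omega, by omega, ?_⟩
    · simp only [mem_blockWord]
      omega
    rw [blockWord_split (b := m) (a := a) (j := t + 2) (by omega) hjm,
      blockWord_cons (b := t + 1) (by omega), blockWord_cons (b := t) (by omega)]
    have h1 : Reduces n (blockWord t a ++ [t + 2]) ([t + 2] ++ blockWord t a) := by
      refine Reduces.swap ?_
      simp only [mem_blockWord, List.mem_singleton]
      omega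
    have h2 : Reduces n (blockWord m (t + 2) ++ blockWord t a)
        (blockWord t a ++ blockWord m (t + 2)) := by
      refine Reduces.swap ?_
      simp only [mem_blockWord]
      omega
    refine Reduces.trans ?_ h2
    rw [blockWord_concat (b := m) (a := t + 2) hjm]
    have h3 : Reduces n [t + 2, t + 1, t + 2] [t + 2] :=
      Reduces.braid (by omega) (by omega) (by omega) (by omega) (by omega)
    have h4 := (Reduces.refl (n := n) (blockWord m (t + 3))).append
      (((Reduces.refl [t + 2, t + 1]).append h1).trans (h3.append (Reduces.refl (blockWord t a))))
    simpa using h4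

/-- A word in letters at most `m` reduces to one in which all `m` occur in a final block. -/
theorem exists_reduces_block {m : ℕ} (hmn : m < n) (u : List ℕ) (hu : Valid n u)
    (hum : ∀ i ∈ u, i ≤ m) :
    ∃ w a, (∀ i ∈ w, i < m) ∧ 1 ≤ a ∧ a ≤ m + 1 ∧ Reduces n u (w ++ blockWord m a) := by
  induction u using List.reverseRecOn with
  | nil => exact ⟨[], m + 1, by simp, by omega, le_rfl, by
      rw [blockWord_of_lt (by omega)]; exact Reduces.refl _⟩
  | append_singleton u j ih =>
    obtain ⟨w, a, hw, ha, ham, hr⟩ := ih (fun i hi => hu i (by simp [hi]))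
      (fun i hi => hum i (by simp [hi]))
    obtain ⟨w', a', hw', ha', ham', hr'⟩ := blockWord_append_reduces (n := n) ha
      (hu j (by simp)).1 (hum j (by simp)) hmn ham
    refine ⟨w ++ w', a', ?_, ha', ham', ?_⟩
    · intro i hi
      rcases List.mem_append.mp hi with hi | hi
      exacts [hw i hi, hw' i hi]
    · have h1 := hr.append (Reduces.refl [j])
      rw [List.append_assoc] at h1 ⊢
      exact h1.trans ((Reduces.refl w).append hr')

/-! ### Existence of Jones normal forms -/

/-- The word spelled by a list of blocks. -/
def word (L : List (ℕ × ℕ)) : List ℕ := (L.map fun p => blockWord p.1 p.2).flatten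

@[simp] theorem word_nil : word [] = [] := rfl

@[simp] theorem word_cons (p : ℕ × ℕ) (L : List (ℕ × ℕ)) :
    word (p :: L) = blockWord p.1 p.2 ++ word L := by
  simp [word]

@[simp] theorem word_append (L L' : List (ℕ × ℕ)) : word (L ++ L') = word L ++ word L' := by
  simp [word]

/-- The list of blocks of a word in Jones normal form. -/
structure IsJones (n : ℕ) (L : List (ℕ × ℕ)) : Prop where
  valid : ∀ p ∈ L, 1 ≤ p.2 ∧ p.2 ≤ p.1 ∧ p.1 < n
  increasing : L.Pairwise fun p q => p.1 < q.1 ∧ p.2 < q.2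

theorem head_mem_word {L : List (ℕ × ℕ)} {p : ℕ × ℕ} (hp : p ∈ L) (hp' : p.2 ≤ p.1) :
    p.1 ∈ word L := by
  simp only [word, List.mem_flatten, List.mem_map]
  exact ⟨_, ⟨p, hp, rfl⟩, mem_blockWord.mpr ⟨hp', le_rfl⟩⟩

theorem mem_word {L : List (ℕ × ℕ)} {i : ℕ} : i ∈ word L ↔ ∃ p ∈ L, p.2 ≤ i ∧ i ≤ p.1 := by
  simp only [word, List.mem_flatten, List.mem_map]
  constructor
  · rintro ⟨_, ⟨p, hp, rfl⟩, hi⟩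
    exact ⟨p, hp, mem_blockWord.mp hi⟩
  · rintro ⟨p, hp, hi⟩
    exact ⟨_, ⟨p, hp, rfl⟩, mem_blockWord.mpr hi⟩

theorem IsJones.valid_word {L : List (ℕ × ℕ)} (hL : IsJones n L) : Valid n (word L) := by
  intro i hi
  obtain ⟨p, hp, hi⟩ := mem_word.mp hi
  have := hL.valid p hp
  omega

/-- Two blocks in the wrong order reduce to a shorter word. -/
theorem blockWord_append_blockWord_reduces {b a b' a' : ℕ} (ha : 1 ≤ a) (haa : a ≤ a')
    (hab : a' ≤ b') (hbb : b' < b) (hb : b < n) :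
    ∃ w, Reduces n (blockWord b' a' ++ blockWord b a) w ∧
      w.length < (blockWord b' a' ++ blockWord b a).length := by
  obtain ⟨t, rfl⟩ : ∃ t, a' = t + 1 := ⟨a' - 1, by omega⟩
  rw [blockWord_concat hab, blockWord_split (b := b) (a := a) (j := t + 2) (by omega) (by omega),
    blockWord_cons (b := t + 1) (by omega), blockWord_cons (b := t) (by omega)]
  -- The final letter t + 1 of the first block slides right past b, …, t + 3 and is absorbed in the
  -- braid t + 1, t + 2, t + 1, which saves two letters.
  refine ⟨blockWord b' (t + 1 + 1) ++ (blockWord b (t + 2 + 1) ++ ([t + 1] ++ blockWord t a)),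
    ?_, by simp⟩
  have h1 : Reduces n ([t + 1] ++ blockWord b (t + 2 + 1)) (blockWord b (t + 2 + 1) ++ [t + 1]) := by
    refine Reduces.swap ?_
    simp only [mem_blockWord, List.mem_singleton]
    omega
  have h2 : Reduces n [t + 1, t + 2, t + 1] [t + 1] :=
    Reduces.braid (by omega) (by omega) (by omega) (by omega) (by omega)
  have h3 := (Reduces.refl (n := n) (blockWord b' (t + 1 + 1))).append
    ((h1.append (Reduces.refl ([t + 2, t + 1] ++ blockWord t a))).trans
      (show Reduces n _ (blockWord b (t + 2 + 1) ++ ([t + 1] ++ blockWord t a)) by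
        simpa using (Reduces.refl (n := n) (blockWord b (t + 2 + 1))).append
          (h2.append (Reduces.refl (blockWord t a)))))
  simpa using h3

/-- Outer induction on length, inner induction on the largest letter. The block of the largest
letter is moved to the end and the rest is normalised; if the last two blocks are then in the wrong
order, the word shortens and the outer induction applies. -/
theorem exists_jones_of_length (N : ℕ) : ∀ m < n, ∀ u : List ℕ, u.length = N → Valid n u →
    (∀ i ∈ u, i ≤ m) → ∃ L, IsJones n L ∧ Reduces n u (word L) := by
  induction N using Nat.strong_induction_on with
  | _ N ihN =>
  -- The bound `≤ N` instead of equality lets the inner induction apply to the remaining word, whose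
  -- length is not controlled exactly.
  have key : ∀ m < n, ∀ u : List ℕ, u.length ≤ N → Valid n u →
      (∀ i ∈ u, i ≤ m) → ∃ L, IsJones n L ∧ Reduces n u (word L) := by
    intro m
    induction m with
    | zero =>
      intro _ u _ hu hum
      have : u = [] := by
        rw [List.eq_nil_iff_forall_not_mem]
        intro i hi
        have := hu i hi
        have := hum i hi
        omega
      subst this
      exact ⟨[], ⟨by simp, by simp⟩, Reduces.refl _⟩
    | succ m ihm =>
      intro hmn u huN hu hum
      obtain ⟨w, a, hw, ha, ham, hr⟩ := exists_reduces_block hmn u hu hum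
      have hv := hr.valid hu
      have hlen := hr.length_le
      obtain ⟨L, hL, hrL⟩ := ihm (by omega) w (by simp at hlen; omega)
        (fun i hi => hv i (by simp [hi])) (fun i hi => Nat.lt_succ_iff.mp (hw i hi))
      have hr' := hr.trans (hrL.append (Reduces.refl _))
      rcases Nat.eq_or_lt_of_le ham with rfl | ham
      · rw [blockWord_of_lt (by omega), List.append_nil] at hr'
        exact ⟨L, hL, hr'⟩
      have hLm : ∀ p ∈ L, p.1 < m + 1 := fun p hp =>
        hw _ (hrL.subset (head_mem_word hp (hL.valid p hp).2.1))
      by_cases hlast : ∀ p ∈ L, p.2 < a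
      · refine ⟨L ++ [(m + 1, a)], ⟨?_, ?_⟩, by simpa using hr'⟩
        · intro p hp
          rcases List.mem_append.mp hp with hp | hp
          · exact hL.valid p hp
          · rw [List.mem_singleton.mp hp]
            exact ⟨ha, by omega, hmn⟩
        · rw [List.pairwise_append]
          refine ⟨hL.increasing, by simp, ?_⟩
          intro p hp q hq
          rw [List.mem_singleton.mp hq]
          exact ⟨hLm p hp, hlast p hp⟩
      · rcases List.eq_nil_or_concat L with rfl | ⟨L, p, rfl⟩
        · simp at hlast
        rw [List.concat_eq_append] at *
        have hp := hL.valid p (by simp)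
        have hpa : a ≤ p.2 := by
          by_contra! hlt
          refine hlast fun q hq => ?_
          rcases List.mem_append.mp hq with hq | hq
          · have := (List.pairwise_append.mp hL.increasing).2.2 q hq p (by simp)
            omega
          · rwa [List.mem_singleton.mp hq]
        obtain ⟨v, hv1, hv2⟩ := blockWord_append_blockWord_reduces (n := n) ha hpa hp.2.1
          (hLm p (by simp)) hmn
        have hr'' : Reduces n u (word L ++ v) := by
          refine hr'.trans ?_
          simpa using (Reduces.refl (word L)).append hv1
        have hlen' := hr'.length_le
        obtain ⟨L', hL', hrL'⟩ := ihN (word L ++ v).length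
          (by simp at hlen' hv2 ⊢; omega) (m + 1) hmn _ rfl (hr''.valid hu)
          (fun i hi => hum i (hr''.subset hi))
        exact ⟨L', hL', hr''.trans hrL'⟩
  exact fun m hm u hu => key m hm u hu.le

/-- Every word reduces to a Jones normal form. -/
theorem exists_jones (u : List ℕ) (hu : Valid n u) : ∃ L, IsJones n L ∧ Reduces n u (word L) := by
  rcases Nat.eq_zero_or_pos n with rfl | hn
  · have : u = [] := List.eq_nil_iff_forall_not_mem.mpr fun i hi => by
      have := hu i hi
      omega
    subst this
    exact ⟨[], ⟨by simp, by simp⟩, Reduces.refl _⟩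
  · exact exists_jones_of_length _ (n - 1) (by omega) u rfl hu fun i hi => by
      have := hu i hi
      omega

/-! ### The action on matchings -/

/-- The bottom (`false`) and top (`true`) points of a diagram. -/
abbrev Point : Type := Bool × ℕ

/-- Perfect matchings of the points. -/
abbrev Matching : Type := {f : Point → Point // (∀ z, f (f z) = z) ∧ ∀ z, f z ≠ z}

/-- Match `x` with `y`, and the former partner of `x` with that of `y`. -/
def rejoin {α : Type*} [DecidableEq α] (x y : α) (f : α → α) (z : α) : α :=
  if z = x then y else if z = y then x else if z = f x then f y else if z = f y then f x else f z

variable {α : Type*} [DecidableEq α]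

theorem rejoin_involutive {x y : α} (hxy : x ≠ y) {f : α → α}
    (hf : (∀ z, f (f z) = z) ∧ ∀ z, f z ≠ z) :
    (∀ z, rejoin x y f (rejoin x y f z) = z) ∧ ∀ z, rejoin x y f z ≠ z := by
  obtain ⟨h1, h2⟩ := hf
  constructor
  · intro z
    unfold rejoin
    grind
  · intro z
    unfold rejoin
    grind

theorem rejoin_symm (x y : α) {f : α → α}
    (hf : (∀ z, f (f z) = z) ∧ ∀ z, f z ≠ z) : rejoin x y f = rejoin y x f := by
  obtain ⟨h1, h2⟩ := hf
  funext z
  unfold rejoin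
  grind

theorem rejoin_comm {x y x' y' : α} (h1 : x ≠ y) (h2 : x' ≠ y') (h3 : x ≠ x') (h4 : x ≠ y')
    (h5 : y ≠ x') (h6 : y ≠ y') {f : α → α} (hf : (∀ z, f (f z) = z) ∧ ∀ z, f z ≠ z) :
    rejoin x y (rejoin x' y' f) = rejoin x' y' (rejoin x y f) := by
  obtain ⟨hf1, hf2⟩ := hf
  funext z
  unfold rejoin
  grind (splits := 30)

theorem rejoin_braid {x y w : α} (h1 : x ≠ y) (h3 : x ≠ w)
    {f : α → α} (hf : (∀ z, f (f z) = z) ∧ ∀ z, f z ≠ z) :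
    rejoin x y (rejoin y w (rejoin x y f)) = rejoin x y f := by
  obtain ⟨hf1, hf2⟩ := hf
  funext z
  unfold rejoin
  grind

/-- The number of loops created when `x` and `y` are capped off. -/
def loops {α : Type*} [DecidableEq α] (x y : α) (f : α → α) : ℕ := if f x = y then 1 else 0

/-- Only the sum is independent of the order: if the two pairs are joined crosswise, the loop is
closed by whichever cap comes second. -/
theorem loops_comm {x y x' y' : α} (h1 : x ≠ y) (h3 : x ≠ x') (h4 : x ≠ y')
    (h5 : y ≠ x') (h6 : y ≠ y') {f : α → α} (hf : (∀ z, f (f z) = z) ∧ ∀ z, f z ≠ z) :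
    loops x y f + loops x' y' (rejoin x y f) = loops x' y' f + loops x y (rejoin x' y' f) := by
  obtain ⟨hf1, hf2⟩ := hf
  unfold loops rejoin
  grind

theorem loops_symm (x y : α) {f : α → α}
    (hf : (∀ z, f (f z) = z) ∧ ∀ z, f z ≠ z) : loops x y f = loops y x f := by
  obtain ⟨hf1, hf2⟩ := hf
  unfold loops
  grind

theorem loops_rejoin {x y w : α} (h1 : x ≠ y) (h3 : x ≠ w)
    {f : α → α} (hf : (∀ z, f (f z) = z) ∧ ∀ z, f z ≠ z) :
    loops y w (rejoin x y f) = 0 := by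
  obtain ⟨hf1, hf2⟩ := hf
  unfold loops rejoin
  grind

theorem loops_rejoin_self {x y : α} {f : α → α} : loops x y (rejoin x y f) = 1 := by
  simp [loops, rejoin]

theorem rejoin_self {x y : α} (h1 : x ≠ y)
    {f : α → α} (hf : (∀ z, f (f z) = z) ∧ ∀ z, f z ≠ z) :
    rejoin x y (rejoin x y f) = rejoin x y f := by
  obtain ⟨hf1, hf2⟩ := hf
  funext z
  unfold rejoin
  grind

/-- A number of loops together with a matching. -/
abbrev State : Type := ℕ × Matching

theorem bottom_ne {i j : ℕ} (hij : i ≠ j) : ((false, i) : Point) ≠ (false, j) := by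
  simpa using hij

/-- The action of `h_i`. -/
def letterAct (i : ℕ) (s : State) : State :=
  (s.1 + loops (false, i) (false, i + 1) s.2.1,
    ⟨rejoin (false, i) (false, i + 1) s.2.1, rejoin_involutive (bottom_ne (by omega)) s.2.2⟩)

theorem letterAct_comm {i j : ℕ} (hij : i + 2 ≤ j ∨ j + 2 ≤ i) (s : State) :
    letterAct j (letterAct i s) = letterAct i (letterAct j s) := by
  have h1 : ((false, i) : Point) ≠ (false, i + 1) := bottom_ne (by omega)
  have h2 : ((false, j) : Point) ≠ (false, j + 1) := bottom_ne (by omega)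
  have h3 : ((false, i) : Point) ≠ (false, j) := bottom_ne (by omega)
  have h4 : ((false, i) : Point) ≠ (false, j + 1) := bottom_ne (by omega)
  have h5 : ((false, i + 1) : Point) ≠ (false, j) := bottom_ne (by omega)
  have h6 : ((false, i + 1) : Point) ≠ (false, j + 1) := bottom_ne (by omega)
  refine Prod.ext ?_ (Subtype.ext ?_)
  · simp only [letterAct, add_assoc]
    rw [loops_comm h1 h3 h4 h5 h6 s.2.2]
  · exact (rejoin_comm h1 h2 h3 h4 h5 h6 s.2.2).symm

theorem letterAct_braid {i j : ℕ} (hij : i + 1 = j ∨ j + 1 = i) (s : State) :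
    letterAct i (letterAct j (letterAct i s)) = letterAct i s := by
  -- Three consecutive points can be read in either direction, so one computation serves both
  -- orientations; the symmetry lemmas then restore the order of each pair.
  have key : ∀ x y w : Point, x ≠ y → y ≠ w → x ≠ w →
      loops y w (rejoin x y s.2.1) = 0 ∧ loops x y (rejoin y w (rejoin x y s.2.1)) = 0 ∧
      rejoin x y (rejoin y w (rejoin x y s.2.1)) = rejoin x y s.2.1 := by
    intro x y w h1 h2 h3
    have hf := rejoin_involutive h1 s.2.2
    refine ⟨loops_rejoin h1 h3 s.2.2, ?_, rejoin_braid h1 h3 s.2.2⟩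
    rw [rejoin_symm y w hf, loops_symm x y (rejoin_involutive h2.symm hf)]
    exact loops_rejoin h2.symm h3.symm hf
  rcases hij with rfl | rfl
  · obtain ⟨k1, k2, k3⟩ := key (false, i) (false, i + 1) (false, i + 1 + 1)
      (bottom_ne (by omega)) (bottom_ne (by omega)) (bottom_ne (by omega))
    exact Prod.ext (by simp only [letterAct, k1, k2, add_zero]) (Subtype.ext k3)
  · have e1 : ((false, j + 1 + 1) : Point) ≠ (false, j + 1) := bottom_ne (by omega)
    have e2 : ((false, j + 1) : Point) ≠ (false, j) := bottom_ne (by omega)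
    obtain ⟨k1, k2, k3⟩ := key (false, j + 1 + 1) (false, j + 1) (false, j) e1 e2
      (bottom_ne (by omega))
    have hf := rejoin_involutive e1 s.2.2
    have hf' := rejoin_involutive e2 hf
    rw [loops_symm _ _ hf] at k1
    rw [loops_symm _ _ hf'] at k2
    rw [rejoin_symm _ _ hf'] at k3
    rw [rejoin_symm _ _ hf, rejoin_symm _ _ s.2.2] at k2 k3
    rw [rejoin_symm _ _ s.2.2] at k1
    exact Prod.ext (by simp only [letterAct, k1, k2, add_zero]) (Subtype.ext k3)

theorem letterAct_self (i : ℕ) (s : State) :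
    letterAct i (letterAct i s) = ((letterAct i s).1 + 1, (letterAct i s).2) := by
  refine Prod.ext ?_ (Subtype.ext ?_)
  · simp only [letterAct, loops_rejoin_self]
  · exact rejoin_self (bottom_ne (by omega)) s.2.2

/-- The action of the generators. -/
def genAct : Gen n → State → State
  | Gen.c, s => (s.1 + 1, s.2)
  | Gen.h i _ _, s => letterAct i s

/-- The right action of the Kauffman monoid on states. -/
def action (n : ℕ) : K n →* (Function.End State)ᵐᵒᵖ :=
  PresentedMonoid.lift (M := (Function.End State)ᵐᵒᵖ)
    (fun g => MulOpposite.op (α := Function.End State) (genAct g)) (by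
    intro u v huv
    apply MulOpposite.unop_injective
    funext s
    cases huv with
    | comm i j hi hi' hj hj' hij => exact letterAct_comm hij s
    | braid i j hi hi' hj hj' hij => exact letterAct_braid hij s
    | square i hi hi' =>
      refine (letterAct_self i s).trans ?_
      change _ = letterAct i (s.1 + 1, s.2)
      simp only [letterAct]
      congr 1
      omega
    | central i hi hi' =>
      change letterAct i (s.1 + 1, s.2) = ((letterAct i s).1 + 1, (letterAct i s).2)
      simp only [letterAct]
      congr 1
      omega)

/-- The state obtained from `s` by acting with `x`. -/
def run (x : K n) (s : State) : State := (action n x).unop s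

theorem run_one (s : State) : run (1 : K n) s = s := by
  simp only [run, map_one]
  rfl

theorem run_mul (x y : K n) (s : State) : run (x * y) s = run y (run x s) := by
  simp only [run, map_mul]
  rfl

theorem run_h {i : ℕ} (hi : 1 ≤ i) (hi' : i < n) (s : State) : run (h n i) s = letterAct i s := by
  rw [h_of_valid hi hi']
  rfl

theorem run_c_pow (l : ℕ) (s : State) : run (c n ^ l) s = (s.1 + l, s.2) := by
  induction l with
  | zero => simp [run_one]
  | succ l ih =>
    rw [pow_succ, run_mul, ih]
    rfl

/-! ### Uniqueness of Jones normal forms -/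

/-- The bottom points joined to a point further to the right. -/
def bottoms (f : Point → Point) : Set ℕ := {j | j < (f (false, j)).2}

/-- The top points joined to a point further to the left. -/
def tops (f : Point → Point) : Set ℕ := {j | (f (true, j)).2 < j}

/-- One letter of a descending block: the first alternative for i + 1 is the start of the block,
where the strand is still vertical, and the second is a later letter, where the previous one left an
arc from i + 1 to i + 2. The former partner of i passes to the former partner of i + 1, so the arc
moves one place left and a new top point appears only at the start. -/
theorem rejoin_step {f : Point → Point} (hf : (∀ z, f (f z) = z) ∧ ∀ z, f z ≠ z) {i : ℕ}
    (hi : (f (false, i)).2 ≤ i) (hi' : f (false, i + 1) = (true, i + 1) ∨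
      f (false, i + 1) = (false, i + 2)) :
    loops (false, i) (false, i + 1) f = 0 ∧
    rejoin (false, i) (false, i + 1) f (false, i) = (false, i + 1) ∧
    (∀ j, j ∈ bottoms (rejoin (false, i) (false, i + 1) f) ↔
      j = i ∨ (j ∈ bottoms f ∧ j ≠ i + 1)) ∧
    (∀ j, j ∈ tops (rejoin (false, i) (false, i + 1) f) ↔
      j ∈ tops f ∨ (f (false, i + 1) = (true, i + 1) ∧ j = i + 1)) ∧
    (∀ j, i + 1 < j → f (false, j) = (true, j) →
      rejoin (false, i) (false, i + 1) f (false, j) = (true, j)) := by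
  obtain ⟨hf1, hf2⟩ := hf
  have hne : f (false, i) ≠ (false, i + 1) := by
    intro he
    rw [he] at hi
    simp at hi
  obtain ⟨p, hp⟩ : ∃ p, p = f (false, i) := ⟨_, rfl⟩
  have hp' : f p = (false, i) := by rw [hp, hf1]
  refine ⟨by simp [loops, hne], by simp [rejoin], ?_, ?_, ?_⟩
  · intro j
    simp only [bottoms, Set.mem_ofPred_eq, rejoin]
    rcases hi' with hi' | hi' <;> grind
  · intro j
    simp only [tops, Set.mem_ofPred_eq, rejoin]
    rcases hi' with hi' | hi' <;> grind
  · intro j hj hfj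
    simp only [rejoin]
    rcases hi' with hi' | hi' <;> grind

/-- Each block adds exactly a to `bottoms` and b + 1 to `tops` and closes no loop. The arc (a, a +
1) is carried along because the next letter of the block needs it. -/
theorem run_blockWord (b : ℕ) (hb : b < n) (s : State)
    (hs : ∀ z, b < z → s.2.1 (false, z) = (true, z)) (d : ℕ) : ∀ a, 1 ≤ a → b = a + d →
    (∀ j ∈ bottoms s.2.1, j < a) → ∃ s', run (val n (blockWord b a)) s = s' ∧ s'.1 = s.1 ∧
      s'.2.1 (false, a) = (false, a + 1) ∧
      (∀ j, j ∈ bottoms s'.2.1 ↔ j = a ∨ j ∈ bottoms s.2.1) ∧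
      (∀ j, j ∈ tops s'.2.1 ↔ j ∈ tops s.2.1 ∨ j = b + 1) ∧
      ∀ z, b + 1 < z → s'.2.1 (false, z) = (true, z) := by
  induction d with
  | zero =>
    intro a ha hab hbot
    obtain rfl : b = a := hab
    have hstep := rejoin_step s.2.2 (i := b)
      (by by_contra! hlt; exact lt_irrefl _ (hbot b hlt)) (Or.inl (hs (b + 1) (by omega)))
    obtain ⟨h1, h2, h3, h4, h5⟩ := hstep
    refine ⟨letterAct b s, ?_, by simp [letterAct, h1], h2, ?_, ?_, ?_⟩
    · rw [blockWord_self, val_cons, val_nil, mul_one, run_h ha hb]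
    · intro j
      refine (h3 j).trans (or_congr_right (and_iff_left_of_imp ?_))
      intro hj
      have := hbot j hj
      omega
    · intro j
      refine (h4 j).trans (or_congr_right ?_)
      rw [and_iff_right (hs (b + 1) (by omega))]
    · exact fun z hz => h5 z hz (hs z (by omega))
  | succ d ih =>
    intro a ha hab hbot
    obtain ⟨s', hs', k1, k2, k3, k4, k5⟩ := ih (a + 1) (by omega) (by omega)
      (fun j hj => (hbot j hj).trans (Nat.lt_succ_self a))
    have hstep := rejoin_step s'.2.2 (i := a)
      (by
        by_contra! hlt
        rcases (k3 a).mp hlt with hlt | hlt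
        · omega
        · exact lt_irrefl _ (hbot a hlt)) (Or.inr k2)
    obtain ⟨h1, h2, h3, h4, h5⟩ := hstep
    refine ⟨letterAct a s', ?_, by simp [letterAct, h1, k1], h2, ?_, ?_, ?_⟩
    · rw [blockWord_concat (by omega), val_append, run_mul, hs', val_cons, val_nil, mul_one,
        run_h ha (by omega)]
    · intro j
      refine (h3 j).trans ?_
      rw [k3 j]
      have := hbot j
      grind
    · intro j
      refine (h4 j).trans ?_
      rw [k4 j, k2]
      simp
    · exact fun z hz => h5 z (by omega) (k5 z hz)

/-- The matching of the identity diagram, with `l` loops. -/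
def baseState (l : ℕ) : State := (l, ⟨fun z => (!z.1, z.2), by simp, by
  rintro ⟨b, j⟩
  simp⟩)

/-- The diagram remembers all a_m and all b_m; the vertical strands far to the right are what the
next block requires. -/
theorem run_word {L : List (ℕ × ℕ)} (hL : IsJones n L) (l : ℕ) :
    ∃ s, run (val n (word L)) (baseState l) = s ∧ s.1 = l ∧
      (∀ j, j ∈ bottoms s.2.1 ↔ j ∈ L.map Prod.snd) ∧
      (∀ j, j ∈ tops s.2.1 ↔ j ∈ L.map fun p => p.1 + 1) ∧
      ∀ z, (∀ p ∈ L, p.1 + 1 < z) → s.2.1 (false, z) = (true, z) := by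
  induction L using List.reverseRecOn with
  | nil => exact ⟨_, rfl, by simp [run_one, baseState], by simp [run_one, baseState, bottoms],
      by simp [run_one, baseState, tops], by simp [run_one, baseState]⟩
  | append_singleton L p ih =>
    have hlt := (List.pairwise_append.mp hL.increasing).2.2
    obtain ⟨s, hs, k1, k2, k3, k4⟩ := ih ⟨fun q hq => hL.valid q (by simp [hq]),
      (List.pairwise_append.mp hL.increasing).1⟩
    have hp := hL.valid p (by simp)
    obtain ⟨s', hs', h1, -, h3, h4, h5⟩ := run_blockWord p.1 hp.2.2 s
      (fun z hz => k4 z fun q hq => by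
        have := hlt q hq p (by simp)
        omega) (p.1 - p.2) p.2 hp.1 (by omega) (fun j hj => by
        obtain ⟨q, hq, rfl⟩ := List.mem_map.mp ((k2 j).mp hj)
        exact (hlt q hq p (by simp)).2)
    refine ⟨s', ?_, h1.trans k1, ?_, ?_, ?_⟩
    · rw [word_append, val_append, run_mul, hs]
      simpa using hs'
    · intro j
      rw [h3 j, k2 j, List.map_append, List.mem_append, or_comm]
      simp
    · intro j
      rw [h4 j, k3 j, List.map_append, List.mem_append]
      simp
    · exact fun z hz => h5 z (hz p (by simp))

/-- Distinct Jones normal forms represent distinct elements of `K_n`. -/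
theorem IsJones.unique {L L' : List (ℕ × ℕ)} (hL : IsJones n L) (hL' : IsJones n L') {l l' : ℕ}
    (heq : c n ^ l * val n (word L) = c n ^ l' * val n (word L')) : l = l' ∧ L = L' := by
  obtain ⟨s, hs, h1, h2, h3, -⟩ := run_word hL l
  obtain ⟨s', hs', h1', h2', h3', -⟩ := run_word hL' l'
  have hss : s = s' := by
    have h := congrArg (fun x => run x (baseState 0)) heq
    simp only [run_mul, run_c_pow] at h
    rw [← hs, ← hs']
    simpa [baseState] using h
  subst hss
  -- A strictly increasing list is determined by its set of entries.
  have hsnd : L.map Prod.snd = L'.map Prod.snd := by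
    refine List.Pairwise.eq_of_mem_iff (r := (· < ·)) ?_ ?_ fun j => (h2 j).symm.trans (h2' j)
    · exact List.pairwise_map.mpr (hL.increasing.imp And.right)
    · exact List.pairwise_map.mpr (hL'.increasing.imp And.right)
  have hfst : L.map (fun p => p.1 + 1) = L'.map fun p => p.1 + 1 := by
    refine List.Pairwise.eq_of_mem_iff (r := (· < ·)) ?_ ?_ fun j => (h3 j).symm.trans (h3' j)
    · exact List.pairwise_map.mpr (hL.increasing.imp fun h => Nat.succ_lt_succ h.1)
    · exact List.pairwise_map.mpr (hL'.increasing.imp fun h => Nat.succ_lt_succ h.1)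
  refine ⟨h1.symm.trans h1', ?_⟩
  clear * - hsnd hfst
  induction L generalizing L' with
  | nil => cases L' with
    | nil => rfl
    | cons p L' => simp at hsnd
  | cons p L ih => cases L' with
    | nil => simp at hsnd
    | cons p' L' =>
      simp only [List.map_cons, List.cons.injEq, Nat.add_right_cancel_iff] at hsnd hfst
      rw [ih hsnd.2 hfst.2, Prod.ext hfst.1 hsnd.1]

/-! ### Words of weight zero -/

theorem short_mem {i j : ℕ} (hi : 1 ≤ i) (hi' : i < n) (hj : 1 ≤ j) (hj' : j < n)
    (hij : i + 1 = j ∨ j + 1 = i) : h n i * h n j ∈ Submonoid.closure (shortBlocks n) := by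
  apply Submonoid.subset_closure
  rcases hij with rfl | rfl
  · refine ⟨i, hi, hj', Or.inr ?_⟩
    rw [invBlock, show i + 1 + 1 - i = 2 by omega]
    simp [List.range'_succ]
  · refine ⟨j, hj, hi', Or.inl ?_⟩
    rw [block, show j + 1 + 1 - j = 2 by omega]
    simp [List.range'_succ]

/-- With j = i + 2d + 1, two braid relations give h_i h_{j+2} = (h_{j+2} h_{j+1})(h_i h_j)(h_{j+1}
h_{j+2}), since h_i commutes with the first factor. -/
theorem h_mul_h_mem_of_lt {i : ℕ} (hi : 1 ≤ i) (d : ℕ) (hd : i + 2 * d + 1 < n) :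
    h n i * h n (i + 2 * d + 1) ∈ Submonoid.closure (shortBlocks n) := by
  induction d with
  | zero => exact short_mem hi (by omega) (by omega) hd (by omega)
  | succ d ih =>
    obtain ⟨j, hj⟩ : ∃ j, j = i + 2 * d + 1 := ⟨_, rfl⟩
    rw [show i + 2 * (d + 1) + 1 = j + 2 by omega] at hd ⊢
    have ih := ih (by omega)
    rw [← hj] at ih
    have h1 : h n (j + 2) * h n (j + 1) ∈ Submonoid.closure (shortBlocks n) :=
      short_mem (by omega) (by omega) (by omega) (by omega) (by omega)
    have h2 : h n (j + 1) * h n (j + 2) ∈ Submonoid.closure (shortBlocks n) :=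
      short_mem (by omega) (by omega) (by omega) (by omega) (by omega)
    have hc : Commute (h n i) (h n (j + 2) * h n (j + 1)) :=
      (commute_h (by omega)).mul_right (commute_h (by omega))
    have h3 : h n (j + 1) * h n j * h n (j + 1) = h n (j + 1) :=
      h_mul_h_mul_h (by omega) (by omega) (by omega) (by omega) (by omega)
    have h4 : h n (j + 2) * h n (j + 1) * h n (j + 2) = h n (j + 2) :=
      h_mul_h_mul_h (by omega) (by omega) (by omega) (by omega) (by omega)
    have key : h n i * h n (j + 2) =
        h n (j + 2) * h n (j + 1) * (h n i * h n j) * (h n (j + 1) * h n (j + 2)) := by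
      calc h n i * h n (j + 2)
          = h n i * (h n (j + 2) * h n (j + 1) * h n (j + 2)) := by rw [h4]
        _ = h n i * (h n (j + 2) * (h n (j + 1) * h n j * h n (j + 1)) * h n (j + 2)) := by
          rw [h3]
        _ = h n i * (h n (j + 2) * h n (j + 1)) * h n j * (h n (j + 1) * h n (j + 2)) := by
          simp only [mul_assoc]
        _ = _ := by
          rw [hc.eq]
          simp only [mul_assoc]
    rw [key]
    exact mul_mem (mul_mem h1 ih) h2

theorem h_mul_h_mem {i j : ℕ} (hi : 1 ≤ i) (hi' : i < n) (hj : 1 ≤ j) (hj' : j < n)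
    (hij : sgn j = - sgn i) : h n i * h n j ∈ Submonoid.closure (shortBlocks n) := by
  have hpar : Odd j ↔ ¬ Odd i := by
    unfold sgn at hij
    grind
  by_cases hadj : i + 1 = j ∨ j + 1 = i
  · exact short_mem hi hi' hj hj' hadj
  rcases lt_trichotomy i j with hlt | rfl | hlt
  · obtain ⟨d, rfl⟩ : ∃ d, j = i + 2 * d + 1 := ⟨(j - i - 1) / 2, by grind⟩
    exact h_mul_h_mem_of_lt hi d hj'
  · grind
  · rw [(commute_h (n := n) (show i + 2 ≤ j ∨ j + 2 ≤ i by omega)).eq]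
    obtain ⟨d, rfl⟩ : ∃ d, i = j + 2 * d + 1 := ⟨(i - j - 1) / 2, by grind⟩
    exact h_mul_h_mem_of_lt hj d hi'

/-- For a neighbour j of i, which exists because n ≥ 3, c h_i = (h_i h_j)(h_j h_i). -/
theorem c_mul_h_mem (hn : 3 ≤ n) {i : ℕ} (hi : 1 ≤ i) (hi' : i < n) :
    c n * h n i ∈ Submonoid.closure (shortBlocks n) := by
  obtain ⟨j, hj, hj', hij⟩ : ∃ j, 1 ≤ j ∧ j < n ∧ (i + 1 = j ∨ j + 1 = i) := by
    by_cases h : i + 1 < n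
    · exact ⟨i + 1, by omega, h, Or.inl rfl⟩
    · exact ⟨i - 1, by omega, by omega, by omega⟩
  have key : c n * h n i = h n i * h n j * (h n j * h n i) := by
    rw [mul_assoc, ← mul_assoc (h n j), h_mul_self hj hj', mul_assoc, ← mul_assoc (h n i),
      ← (commute_c (h n i)).eq, mul_assoc, ← mul_assoc (h n i), h_mul_h_mul_h hi hi' hj hj' hij]
  rw [key]
  exact mul_mem (short_mem hi hi' hj hj' hij) (short_mem hj hj' hi hi' (by omega))

theorem c_pow_mul_h_mem (hn : 3 ≤ n) {i : ℕ} (hi : 1 ≤ i) (hi' : i < n) (t : ℕ) :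
    c n ^ (2 * t + 1) * h n i ∈ Submonoid.closure (shortBlocks n) := by
  induction t with
  | zero => simpa using c_mul_h_mem hn hi hi'
  | succ t ih =>
    have key : c n ^ (2 * (t + 1) + 1) * h n i = c n ^ (2 * t + 1) * h n i * (c n * h n i) := by
      rw [← h_mul_self hi hi', mul_assoc, ← mul_assoc (h n i), h_mul_self hi hi', mul_assoc,
        h_mul_self hi hi', ← mul_assoc, ← mul_assoc, ← pow_succ, ← pow_succ]
      congr 1
    rw [key]
    exact mul_mem ih (c_mul_h_mem hn hi hi')

/-- Discrete intermediate value argument: partial weights change by ±1, so a sum going from positive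
to non-positive passes through 0. -/
theorem exists_prefix {σ : ℤ} (hσ : σ = 1 ∨ σ = -1) (v : List ℕ) : ∀ k : ℤ, 0 < k →
    k + σ * wt v ≤ 0 → ∃ s t, v = s ++ t ∧ k + σ * wt s = 0 := by
  induction v with
  | nil =>
    intro k hk hkv
    simp at hkv
    omega
  | cons i v ih =>
    intro k hk hkv
    rw [wt_cons] at hkv
    have hs := sgn_eq i
    have hσi : σ * sgn i = 1 ∨ σ * sgn i = -1 := by
      rcases hσ with rfl | rfl <;> rcases hs with hs | hs <;> simp [hs]
    rcases eq_or_ne (k + σ * sgn i) 0 with h0 | h0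
    · exact ⟨[i], v, rfl, by simpa using h0⟩
    · obtain ⟨s, t, rfl, hst⟩ := ih (k + σ * sgn i) (by omega) (by linarith)
      exact ⟨i :: s, t, rfl, by rw [wt_cons]; linarith⟩

theorem wt_blockWord (a d : ℕ) : wt (blockWord (a + d) a) = if Even d then sgn a else 0 := by
  induction d with
  | zero => simp [blockWord_self]
  | succ d ih =>
    rw [← add_assoc, blockWord_cons (by omega), wt_cons, ih, sgn_succ]
    have hsd : sgn (a + d) = if Even d then sgn a else - sgn a := by
      clear ih
      induction d with
      | zero => simp
      | succ d ih =>
        rw [← add_assoc, sgn_succ, ih]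
        grind
    rw [hsd]
    grind

theorem wt_blockWord_eq {b a : ℕ} (hab : a ≤ b) :
    wt (blockWord b a) = if sgn a = sgn b then sgn b else 0 := by
  obtain ⟨d, rfl⟩ := Nat.exists_eq_add_of_le hab
  rw [wt_blockWord]
  unfold sgn
  grind

theorem wt_word_of_forall_sgn {σ : ℤ} (hσ : σ = 1 ∨ σ = -1) (L : List (ℕ × ℕ))
    (hL : ∀ p ∈ L, p.2 ≤ p.1) (hs : ∀ p ∈ L, sgn p.1 = σ) : 0 ≤ σ * wt (word L) := by
  induction L with
  | nil => simp
  | cons p L ih =>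
    rw [word_cons, wt_append, mul_add]
    refine add_nonneg ?_ (ih (fun q hq => hL q (by simp [hq])) fun q hq => hs q (by simp [hq]))
    rw [wt_blockWord_eq (hL p (by simp)), hs p (by simp)]
    rcases hσ with rfl | rfl <;> split_ifs <;> simp

theorem exists_first_not {α : Type*} (P : α → Prop) (L : List α) :
    (∀ p ∈ L, P p) ∨ ∃ L₁ p L₂, L = L₁ ++ p :: L₂ ∧ (∀ q ∈ L₁, P q) ∧ ¬ P p := by
  induction L with
  | nil => simp
  | cons a L ih =>
    by_cases ha : P a
    · rcases ih with ih | ⟨L₁, p, L₂, rfl, h1, h2⟩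
      · left
        simpa [ha] using ih
      · exact Or.inr ⟨a :: L₁, p, L₂, rfl, by simpa [ha] using h1, h2⟩
    · exact Or.inr ⟨[], a, L, rfl, by simp, ha⟩

theorem wt_perm {u v : List ℕ} (huv : u.Perm v) : wt u = wt v := (huv.map sgn).sum_eq

/-- A nonempty Jones normal form of weight zero can be rearranged so as to start with two letters
of opposite signs. -/
theorem IsJones.exists_pair {L : List (ℕ × ℕ)} (hL : IsJones n L) (hne : L ≠ [])
    (hwt : wt (word L) = 0) : ∃ i j w, sgn j = - sgn i ∧ val n (word L) = val n (i :: j :: w) ∧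
      (word L).Perm (i :: j :: w) := by
  obtain ⟨p, L', rfl⟩ := List.exists_cons_of_ne_nil hne
  have hp := hL.valid p (by simp)
  rcases exists_first_not (fun q : ℕ × ℕ => sgn q.1 = sgn p.1) (p :: L') with
    hall | ⟨L₁, q, L₂, hsplit, h1, h2⟩
  -- If all top indices have the same sign, no block has weight of the opposite sign. So total
  -- weight 0 excludes a one-letter first block, and its first two letters serve.
  · have h3 := wt_word_of_forall_sgn (sgn_eq p.1) L' (fun q hq => (hL.valid q (by simp [hq])).2.1)
      (fun q hq => hall q (by simp [hq]))
    rw [word_cons, wt_append, wt_blockWord_eq hp.2.1] at hwt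
    have hlt : p.2 < p.1 := by
      rcases Nat.eq_or_lt_of_le hp.2.1 with he | hlt
      · rw [he, if_pos rfl] at hwt
        rcases sgn_eq p.1 with hs | hs <;> rw [hs] at hwt h3 <;> linarith
      · exact hlt
    obtain ⟨t, ht⟩ : ∃ t, p.1 = t + 2 := ⟨p.1 - 2, by omega⟩
    refine ⟨t + 2, t + 1, blockWord t p.2 ++ word L', by simp [sgn_succ], ?_⟩
    have : word (p :: L') = (t + 2) :: (t + 1) :: (blockWord t p.2 ++ word L') := by
      rw [word_cons, ht, blockWord_cons (by omega), blockWord_cons (by omega)]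
      rfl
    rw [this]
    exact ⟨rfl, List.Perm.refl _⟩
  · rcases List.eq_nil_or_concat L₁ with rfl | ⟨L₀, r, rfl⟩
    · simp only [List.nil_append, List.cons.injEq] at hsplit
      exact absurd (by rw [hsplit.1]) h2
    rw [List.concat_eq_append] at *
    rw [hsplit] at hL ⊢
    have hr := hL.valid r (by simp)
    have hq := hL.valid q (by simp)
    have hinc := List.pairwise_append.mp hL.increasing
    have hrq := (hinc.2.2 r (by simp) q (by simp)).1
    have hrs : sgn r.1 = sgn p.1 := h1 r (by simp)
    -- The top indices up to r.1 increase and share their parity, so they differ by at least 2.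
    -- Hence r.1 commutes past all earlier blocks, and q.1 > r.1 commutes past these and past the
    -- rest of the block of r.
    have hlow : ∀ x ∈ word L₀, x + 2 ≤ r.1 := by
      intro x hx
      obtain ⟨q', hq', hx⟩ := mem_word.mp hx
      have hlt := ((List.pairwise_append.mp hinc.1).2.2 q' hq' r (by simp)).1
      have hs : sgn q'.1 = sgn r.1 := (h1 q' (by simp [hq'])).trans hrs.symm
      have : r.1 ≠ q'.1 + 1 := by
        intro he
        rw [he, sgn_succ] at hs
        rcases sgn_eq q'.1 with h | h <;> rw [h] at hs <;> omega
      omega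
    obtain ⟨r', hr'⟩ : ∃ r', r.1 = r' + 1 := ⟨r.1 - 1, by omega⟩
    obtain ⟨q', hq'⟩ : ∃ q', q.1 = q' + 1 := ⟨q.1 - 1, by omega⟩
    have hword : word (L₀ ++ [r] ++ q :: L₂) = word L₀ ++ ([r.1] ++ (blockWord r' r.2 ++
        ([q.1] ++ (blockWord q' q.2 ++ word L₂)))) := by
      rw [word_append, word_append, word_cons, word_cons, hr', blockWord_cons (by omega), hq',
        blockWord_cons (by omega)]
      simp
    refine ⟨r.1, q.1, word L₀ ++ (blockWord r' r.2 ++ (blockWord q' q.2 ++ word L₂)), ?_, ?_, ?_⟩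
    · rw [hrs]
      have := sgn_eq q.1
      have := sgn_eq p.1
      omega
    · have c1 : Commute (val n (word L₀)) (val n [r.1]) := commute_val fun i hi j hj => by
        rw [List.mem_singleton.mp hj]
        exact Or.inl (hlow i hi)
      have c2 : Commute (val n (word L₀)) (val n [q.1]) := commute_val fun i hi j hj => by
        have := hlow i hi
        rw [List.mem_singleton.mp hj]
        omega
      have c3 : Commute (val n (blockWord r' r.2)) (val n [q.1]) := commute_val fun i hi j hj => by
        have := mem_blockWord.mp hi
        rw [List.mem_singleton.mp hj]
        omega
      rw [hword, show ∀ w, r.1 :: q.1 :: w = [r.1] ++ ([q.1] ++ w) from fun _ => rfl]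
      simp only [val_append]
      rw [← mul_assoc, c1.eq, mul_assoc, ← mul_assoc (val n (blockWord r' r.2)), c3.eq, mul_assoc,
        ← mul_assoc (val n (word L₀)), c2.eq]
      simp only [mul_assoc]
    · rw [hword]
      grind

/-- Strong induction on length, splitting off a factor already known to be generated by short
blocks. Without any `c`, the word is normalised first: either it gets shorter and yields powers of
`c`, or it begins, up to commutation, with two letters of opposite sign. -/
theorem c_pow_mul_val_mem_of_length (hn : 3 ≤ n) (N : ℕ) : ∀ v : List ℕ, v.length = N →
    Valid n v → ∀ l : ℕ, |wt v| ≤ l → Even (l - wt v) → (v ≠ [] ∨ l = 0) →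
    c n ^ l * val n v ∈ Submonoid.closure (shortBlocks n) := by
  induction N using Nat.strong_induction_on with
  | _ N ih =>
  intro v hvN hv l hl hev hvl
  rcases Nat.eq_zero_or_pos l with rfl | hlpos
  · rw [pow_zero, one_mul]
    have hwt : wt v = 0 := by
      rw [← abs_eq_zero]
      exact le_antisymm (by simpa using hl) (abs_nonneg _)
    rcases eq_or_ne v [] with rfl | hne
    · exact one_mem _
    obtain ⟨L, hL, p, q, h1, h2, h3, h4, h5⟩ := exists_jones v hv
    have hLv : Valid n (word L) := hL.valid_word
    rw [h1]
    by_cases hpq : p + q = 0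
    · have hLne : L ≠ [] := by
        rintro rfl
        exact hne (h4 rfl)
      obtain ⟨i, j, w, hij, hval, hperm⟩ := hL.exists_pair hLne (by omega)
      have hmem : ∀ x ∈ i :: j :: w, 1 ≤ x ∧ x < n := fun x hx => hLv x (hperm.mem_iff.mpr hx)
      have hw : wt w = 0 := by
        have := wt_perm hperm
        simp only [wt_cons] at this
        omega
      have hlen := hperm.length_eq
      simp only [List.length_cons] at hlen
      have hi := hmem i (by simp)
      have hj := hmem j (by simp)
      have hrec := ih w.length (by omega) w rfl (fun x hx => hmem x (by simp [hx])) 0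
        (by simp [hw]) (by simp [hw]) (Or.inr rfl)
      rw [hpq, pow_zero, one_mul, hval, val_cons, val_cons, ← mul_assoc]
      exact mul_mem (h_mul_h_mem hi.1 hi.2 hj.1 hj.2 hij) (by simpa using hrec)
    · refine ih (word L).length (by omega) _ rfl hLv _ ?_ ?_ (Or.inl fun h => hne (h4 h))
      · push_cast
        rw [abs_le]
        omega
      · push_cast
        rw [show ((p : ℤ) + q - wt (word L)) = 2 * p by omega]
        exact even_two_mul _
  · obtain ⟨i, v, rfl⟩ := List.exists_cons_of_ne_nil (hvl.resolve_right (by omega))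
    have hi := hv i (by simp)
    have hs := sgn_eq i
    rw [wt_cons] at hl hev
    simp only [List.length_cons] at hvN
    have hv' : Valid n v := fun x hx => hv x (by simp [hx])
    rcases eq_or_ne v [] with rfl | hne
    · obtain ⟨t, rfl⟩ : ∃ t, l = 2 * t + 1 := ⟨l / 2, by rw [wt_nil] at hev; grind⟩
      simpa using c_pow_mul_h_mem hn hi.1 hi.2 t
    obtain ⟨l, rfl⟩ : ∃ k, l = k + 1 := ⟨l - 1, by omega⟩
    -- From here on the exponent of `c` is l + 1. If the tail tolerates losing one `c`, split off c
    -- h_i. Otherwise the tail outweighs i with opposite sign, so some prefix i :: s has weight 0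
    -- and needs no `c`, while the remainder t keeps all of them.
    by_cases hlv : |wt v| ≤ l
    · have hrec := ih v.length (by omega) v rfl hv' l hlv (by grind) (Or.inl hne)
      rw [val_cons, pow_succ, mul_assoc, ← mul_assoc (c n),
        ← mul_assoc, ((commute_c (c n * h n i)).pow_left l).eq, mul_assoc]
      exact mul_mem (c_mul_h_mem hn hi.1 hi.2) hrec
    · obtain ⟨s, t, rfl, hst⟩ := exists_prefix hs v 1 one_pos (by
        push_cast at hl
        rcases hs with hs | hs <;> rw [hs] at hl ⊢ <;> rw [abs_le] at hlv hl <;> omega)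
      have hwts : sgn i + wt s = 0 := by
        rcases hs with hs | hs <;> rw [hs] at hst ⊢ <;> linarith
      rw [wt_append, ← add_assoc, hwts, zero_add] at hl hev
      -- If t were empty, the tail s would have weight ±1, while parity makes l odd, hence at least
      -- 1, contradicting `hlv`.
      have htne : t ≠ [] := by
        rintro rfl
        rw [List.append_nil] at hlv
        apply hlv
        rw [show wt s = - sgn i by omega, abs_neg]
        have : (1 : ℤ) ≤ l := by
          rw [wt_nil] at hev
          grind
        rcases hs with hs | hs <;> rw [hs] <;> simpa using this
      have hlt := List.length_pos_iff.mpr htne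
      rw [List.length_append] at hvN
      have hrec1 := ih (i :: s).length (by simp; omega) _ rfl (fun x hx => hv x (by
        rw [← List.cons_append]
        exact List.mem_append_left _ hx)) 0 (by simp [hwts]) (by simp [hwts]) (Or.inr rfl)
      have hrec2 := ih t.length (by omega) t rfl (fun x hx => hv x (by simp [hx])) (l + 1) hl hev
        (Or.inl htne)
      rw [← List.cons_append, val_append, ← mul_assoc,
        ((commute_c (val n (i :: s))).pow_left (l + 1)).eq, mul_assoc]
      exact mul_mem (by simpa using hrec1) hrec2

theorem c_pow_mul_val_mem (hn : 3 ≤ n) {v : List ℕ} (hv : Valid n v) {l : ℕ} (hl : |wt v| ≤ l)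
    (hev : Even (l - wt v)) (hvl : v ≠ [] ∨ l = 0) :
    c n ^ l * val n v ∈ Submonoid.closure (shortBlocks n) :=
  c_pow_mul_val_mem_of_length hn _ v rfl hv l hl hev hvl

/-! ### The idempotent generated submonoid -/

theorem exists_val_of_mem_closure {x : K n} (hx : x ∈ Submonoid.closure (shortBlocks n)) :
    ∃ u, Valid n u ∧ wt u = 0 ∧ x = val n u := by
  induction hx using Submonoid.closure_induction with
  | mem x hx =>
    obtain ⟨i, hi, hi', rfl | rfl⟩ := hx
    · refine ⟨[i + 1, i], ?_, by simp [sgn_succ], ?_⟩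
      · simp only [Valid, List.mem_cons, List.not_mem_nil, or_false]
        omega
      · rw [block, show i + 1 + 1 - i = 2 by omega]
        simp [List.range'_succ]
    · refine ⟨[i, i + 1], ?_, by simp [sgn_succ], ?_⟩
      · simp only [Valid, List.mem_cons, List.not_mem_nil, or_false]
        omega
      · rw [invBlock, show i + 1 + 1 - i = 2 by omega]
        simp [List.range'_succ]
  | one => exact ⟨[], by simp [Valid], rfl, rfl⟩
  | mul x y _ _ hx hy =>
    obtain ⟨u, hu, hu0, rfl⟩ := hx
    obtain ⟨v, hv, hv0, rfl⟩ := hy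
    refine ⟨u ++ v, ?_, by simp [hu0, hv0], by simp⟩
    intro i hi
    rcases List.mem_append.mp hi with hi | hi
    exacts [hu i hi, hv i hi]

theorem exists_c_pow_mul_val (x : K n) : ∃ l u, Valid n u ∧ x = c n ^ l * val n u := by
  have hx : x ∈ Submonoid.closure (Set.range (PresentedMonoid.of (Rel n))) := by simp
  induction hx using Submonoid.closure_induction with
  | mem x hx =>
    obtain ⟨g, rfl⟩ := hx
    cases g with
    | c => exact ⟨1, [], by simp [Valid], by simp [c]⟩
    | h i hi hi' => exact ⟨0, [i], by simpa [Valid] using ⟨hi, hi'⟩, by simp [h_of_valid hi hi']⟩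
  | one => exact ⟨0, [], by simp [Valid], by simp⟩
  | mul x y _ _ hx hy =>
    obtain ⟨l, u, hu, rfl⟩ := hx
    obtain ⟨m, v, hv, rfl⟩ := hy
    refine ⟨l + m, u ++ v, ?_, ?_⟩
    · intro i hi
      rcases List.mem_append.mp hi with hi | hi
      exacts [hu i hi, hv i hi]
    · rw [val_append, mul_assoc, ← mul_assoc (val n u), ← ((commute_c (val n u)).pow_left m).eq,
        pow_add]
      simp only [mul_assoc]

theorem exists_jones_eq (x : K n) : ∃ l L, IsJones n L ∧ x = c n ^ l * val n (word L) := by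
  obtain ⟨l, u, hu, rfl⟩ := exists_c_pow_mul_val x
  obtain ⟨L, hL, p, q, h1, -⟩ := exists_jones u hu
  exact ⟨l + (p + q), L, hL, by rw [h1, pow_add _ l, mul_assoc]⟩

theorem idempotent_mem (hn : 3 ≤ n) {e : K n} (he : IsIdempotentElem e) :
    e ∈ Submonoid.closure (shortBlocks n) := by
  obtain ⟨l, L, hL, rfl⟩ := exists_jones_eq e
  have hv : Valid n (word L ++ word L) := by
    intro i hi
    rcases List.mem_append.mp hi with hi | hi <;> exact hL.valid_word i hi
  obtain ⟨L', hL', p, q, h1, h2, -⟩ := exists_jones _ hv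
  have heq : c n ^ (l + l + (p + q)) * val n (word L') = c n ^ l * val n (word L) := by
    rw [← he.eq, pow_add, mul_assoc, ← h1, val_append, pow_add, mul_assoc, mul_assoc,
      ← mul_assoc (val n (word L)), ← ((commute_c (val n (word L))).pow_left l).eq]
    simp only [mul_assoc]
  -- Comparing exponents, l + l + (p + q) = l, so l = p = q = 0; then twice the weight equals the
  -- weight.
  obtain ⟨hl, rfl⟩ := hL'.unique hL heq
  rw [wt_append] at h2
  obtain rfl : l = 0 := by omega
  have hwt : wt (word L') = 0 := by omega
  exact c_pow_mul_val_mem hn hL.valid_word (by simp [hwt]) (by simp [hwt]) (Or.inr rfl)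

theorem idempotentGenerated_eq (hn : 3 ≤ n) :
    idempotentGenerated n = Submonoid.closure (shortBlocks n) := by
  refine le_antisymm ((Submonoid.closure_le).mpr fun e he => idempotent_mem hn he)
    (Submonoid.closure_mono ?_)
  have key : ∀ i j, 1 ≤ i → i < n → 1 ≤ j → j < n → (i + 1 = j ∨ j + 1 = i) →
      IsIdempotentElem (h n i * h n j) := by
    intro i j hi hi' hj hj' hij
    rw [IsIdempotentElem, ← mul_assoc, h_mul_h_mul_h hi hi' hj hj' hij]
  rintro x ⟨i, hi, hi', rfl | rfl⟩
  · rw [block, show i + 1 + 1 - i = 2 by omega]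
    simpa [List.range'_succ, idempotents] using
      key (i + 1) i (by omega) hi' hi (by omega) (by omega)
  · rw [invBlock, show i + 1 + 1 - i = 2 by omega]
    simpa [List.range'_succ, idempotents] using
      key i (i + 1) hi (by omega) (by omega) hi' (by omega)

/-! ### The characteristic number as a weight -/

theorem JonesNormalForm.isJones (w : JonesNormalForm n) : IsJones n w.blocks :=
  ⟨w.valid, w.increasing⟩

theorem JonesNormalForm.value_eq (w : JonesNormalForm n) :
    w.value = c n ^ w.cCount * val n (word w.blocks) := by
  rw [value]
  congr 1
  induction w.blocks with
  | nil => rfl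
  | cons p L ih =>
    rw [List.map_cons, List.prod_cons, ih, word_cons, val_append]
    rfl

theorem JonesNormalForm.blue_sub_red (w : JonesNormalForm n) :
    (w.blue : ℤ) - w.red = wt (word w.blocks) := by
  have hv : ∀ p ∈ w.blocks, p.2 ≤ p.1 := fun p hp => (w.valid p hp).2.1
  rw [blue, red]
  generalize w.blocks = L at hv ⊢
  induction L with
  | nil => rfl
  | cons p L ih =>
    rw [word_cons, wt_append, ← ih fun q hq => hv q (by simp [hq]),
      wt_blockWord_eq (hv p (by simp)), List.countP_cons, List.countP_cons]
    unfold sgn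
    simp only [decide_eq_true_eq]
    push_cast
    grind

end Kauffman

theorem theorem3p8 (n : ℕ) (hn : 3 ≤ n) :
    (∀ w : Kauffman.JonesNormalForm n, (w.blocks ≠ [] ∨ w.cCount = 0) →
      (w.value ∈ Kauffman.idempotentGenerated n ↔ 0 ≤ w.chi ∧ Even w.chi)) ∧
    (∀ l : ℕ, 1 ≤ l → Kauffman.c n ^ l ∉ Kauffman.idempotentGenerated n) ∧
    Kauffman.idempotentGenerated n = Submonoid.closure (Kauffman.shortBlocks n) := by
  open Kauffman in
  rw [idempotentGenerated_eq hn]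
  refine ⟨fun w hw => ?_, fun l hl hmem => ?_, rfl⟩
  · rw [w.value_eq, JonesNormalForm.chi, w.blue_sub_red]
    constructor
    · intro hmem
      obtain ⟨u, hu, hu0, hval⟩ := exists_val_of_mem_closure hmem
      obtain ⟨L, hL, p, q, h1, h2, -⟩ := exists_jones u hu
      rw [h1] at hval
      obtain ⟨hl, hL'⟩ := w.isJones.unique hL hval
      rw [hl, hL']
      push_cast
      -- Since u has weight 0, wt (word L) = q - p, so the expression equals 2 min(p, q).
      rcases abs_cases (wt (word L)) with ⟨h, -⟩ | ⟨h, -⟩ <;> rw [h] <;>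
        exact ⟨by omega, by grind⟩
    · rintro ⟨h1, h2⟩
      refine c_pow_mul_val_mem hn w.isJones.valid_word (by linarith) ?_ ?_
      · rcases abs_cases (wt (word w.blocks)) with ⟨h, -⟩ | ⟨h, -⟩ <;> rw [h] at h2 <;> grind
      · refine hw.imp_left fun hne hnil => ?_
        obtain ⟨p, L, hpL⟩ := List.exists_cons_of_ne_nil hne
        have hp : p ∈ w.blocks := by simp [hpL]
        have := head_mem_word hp (w.valid p hp).2.1
        simp [hnil] at this
  · obtain ⟨u, hu, -, hval⟩ := exists_val_of_mem_closure hmem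
    obtain ⟨L, hL, p, q, h1, -, -, h4, -⟩ := exists_jones u hu
    have hnil : IsJones n [] := ⟨by simp, by simp⟩
    -- The normal form of u is empty, and reductions never empty a nonempty word, so u is empty and
    -- c^l = 1.
    obtain ⟨-, rfl⟩ := hnil.unique hL (l := l) (l' := p + q) (by simpa [h1] using hval)
    have hu' := h4 rfl
    subst hu'
    have := (hnil.unique hnil (l := l) (l' := 0) (by simpa using hval)).1
    omega
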